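/- Let $X$ and $Y$ be compact metric spaces. For a compact metric space $Z$ let $\mathrm{Lip}(Z)$ be the set of real-valued Lipschitz functions on $Z$, and let $\Delta(Z)$ be the set of Borel probability measures on $Z$ with the Kantorovich–Rubinstein distance $\sup\{\int f\,d\eta-\int f\,d\eta' : f \text{ is } 1\text{-Lipschitz on } Z\}$. Let $\mu\in\Delta(X)$ (the distribution of firm types), $\nu\in\Delta(Y)$ (the distribution of worker types), and let $V\in\mathrm{Lip}(X\times\Delta(Y))$ be the value function. For $\eta\in\Delta(Y)$ and $q\in \mathrm{Lip}(Y)$ write $\mathbb E_\eta[q]=\int_Y q\,d\eta$. An assignment is a measure $\gamma\in\Delta(X\times\Delta(Y))$ whose marginal on $X$ is $\mu$ and whose average workforce is $\nu$, i.e. $\int \eta(B)\,\gamma(dx,d\eta)=\nu(B)$ for every Borel set $B\subset Y$. A competitive equilibrium $(\gamma;p,q)$ is an assignment $\gamma$ together with $(p,q)\in \mathrm{Lip}(X)\times \mathrm{Lip}(Y)$ such that $$p(x)+\mathbb E_\eta[q]=V(x,\eta)\quad\text{for all }(x,\eta)\in\operatorname{supp}(\gamma),\qquad p(x)+\mathbb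 E_\eta[q]\ge V(x,\eta)\quad\text{for all }(x,\eta)\in X\times\Delta(Y).$$ The planner's problem (P) is to maximize $\int V\,d\gamma$ over all assignments $\gamma$. The dual problem (D) is to minimize $\int p\,d\mu+\int q\,d\nu$ over all $(p,q)\in \mathrm{Lip}(X)\times\mathrm{Lip}(Y)$ with $p(x)+\mathbb E_\eta[q]\ge V(x,\eta)$ for all $(x,\eta)\in X\times\Delta(Y)$. Theorem. A competitive equilibrium exists. Moreover, for $\gamma\in\Delta(X\times\Delta(Y))$ and functions $p:X\to\mathbb R$, $q:Y\to\mathbb R$, $(\gamma;p,q)$ is a competitive equilibrium if and only if $\gamma$ solves (P) and $(p,q)$ solves (D). In particular, (P) and (D) both have solutions and their optimal values are equal. -/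

import Mathlib

open MeasureTheory Set Filter Topology
open scoped NNReal ENNReal

namespace Matching

/-- `Prob Z` is the set `Δ(Z)` of probability measures on `Z`.  (A type of its own, so that it can
carry the Kantorovich-Rubinstein metric.) -/
structure Prob (Z : Type*) [MeasurableSpace Z] where
  toMeasure : Measure Z
  isProb : IsProbabilityMeasure toMeasure

instance {Z : Type*} [MeasurableSpace Z] (η : Prob Z) : IsProbabilityMeasure η.toMeasure :=
  η.isProb

section KantorovichRubinstein

variable {Z : Type*} [MetricSpace Z] [CompactSpace Z] [MeasurableSpace Z] [BorelSpace Z]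

/-- The Kantorovich-Rubinstein distance: the supremum of `∫ f dη - ∫ f dη'` over all `1`-Lipschitz
functions `f`.  Both measures have mass one, so normalizing `f` to vanish at a base point
would change neither the differences nor the supremum, and the mass term of the
Kantorovich-Rubinstein norm vanishes on `η - η'`. -/
noncomputable def krDist (η η' : Prob Z) : ℝ :=
  sSup {r : ℝ | ∃ f : Z → ℝ, LipschitzWith 1 f ∧
    r = ∫ z, f z ∂η.toMeasure - ∫ z, f z ∂η'.toMeasure}

theorem Prob.integrable_of_continuous (η : Prob Z) {f : Z → ℝ} (hf : Continuous f) :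
    Integrable f η.toMeasure :=
  hf.integrable_of_hasCompactSupport (HasCompactSupport.of_compactSpace f)

theorem krDist_bddAbove (η η' : Prob Z) :
    BddAbove {r : ℝ | ∃ f : Z → ℝ, LipschitzWith 1 f ∧
      r = ∫ z, f z ∂η.toMeasure - ∫ z, f z ∂η'.toMeasure} := by
  refine ⟨Metric.diam (univ : Set Z), ?_⟩
  rintro r ⟨f, hf, rfl⟩
  obtain ⟨z₀⟩ : Nonempty Z := η.toMeasure.nonempty_of_neZero
  have hb : ∀ z w, f z - f w ≤ Metric.diam (univ : Set Z) := fun z w => by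
    have h1 := hf.dist_le_mul z w
    have h2 := Metric.dist_le_diam_of_mem (isCompact_univ (X := Z)).isBounded
      (mem_univ z) (mem_univ w)
    have h3 := le_abs_self (f z - f w)
    rw [Real.dist_eq] at h1
    simp only [NNReal.coe_one, one_mul] at h1
    linarith
  obtain ⟨w, -, hw⟩ := (isCompact_univ (X := Z)).exists_isMinOn ⟨z₀, mem_univ _⟩
    hf.continuous.continuousOn
  have h1 : ∫ z, f z ∂η.toMeasure ≤ ∫ _z, (f w + Metric.diam (univ : Set Z)) ∂η.toMeasure :=
    integral_mono (η.integrable_of_continuous hf.continuous) (integrable_const _)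
      (fun z => by have := hb z w; simp only; linarith)
  have h2 : ∫ _z, f w ∂η'.toMeasure ≤ ∫ z, f z ∂η'.toMeasure :=
    integral_mono (integrable_const _) (η'.integrable_of_continuous hf.continuous)
      (fun z => hw (mem_univ z))
  simp only [integral_const, probReal_univ, smul_eq_mul, one_mul] at h1 h2
  linarith

theorem integral_sub_le_krDist (η η' : Prob Z) {f : Z → ℝ} (hf : LipschitzWith 1 f) :
    ∫ z, f z ∂η.toMeasure - ∫ z, f z ∂η'.toMeasure ≤ krDist η η' :=
  le_csSup (krDist_bddAbove η η') ⟨f, hf, rfl⟩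

theorem krDist_le {η η' : Prob Z} {c : ℝ}
    (h : ∀ f : Z → ℝ, LipschitzWith 1 f →
      ∫ z, f z ∂η.toMeasure - ∫ z, f z ∂η'.toMeasure ≤ c) : krDist η η' ≤ c :=
  csSup_le ⟨_, fun _ => 0, LipschitzWith.const' 0, rfl⟩ (by rintro r ⟨f, hf, rfl⟩; exact h f hf)

theorem krDist_comm_le (η η' : Prob Z) : krDist η η' ≤ krDist η' η := by
  refine krDist_le fun f hf => ?_
  have := integral_sub_le_krDist η' η hf.neg
  simp only [Pi.neg_apply, integral_neg] at this
  linarith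

theorem integral_eq_of_krDist_eq_zero {η η' : Prob Z} (h : krDist η η' = 0)
    {K : ℝ≥0} {f : Z → ℝ} (hf : LipschitzWith K f) :
    ∫ z, f z ∂η.toMeasure = ∫ z, f z ∂η'.toMeasure := by
  have hK : (0 : ℝ) < K + 1 := by positivity
  have hg : LipschitzWith 1 (fun z => (K + 1 : ℝ)⁻¹ * f z) := by
    refine LipschitzWith.of_dist_le_mul fun x y => ?_
    have h1 := hf.dist_le_mul x y
    rw [Real.dist_eq] at h1 ⊢
    rw [← mul_sub, abs_mul, abs_of_pos (inv_pos.2 hK), NNReal.coe_one, one_mul,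
      inv_mul_le_iff₀ hK]
    have := dist_nonneg (x := x) (y := y)
    linarith
  have h1 := integral_sub_le_krDist η η' hg
  have h2 := integral_sub_le_krDist η' η hg
  have h3 := krDist_comm_le η' η
  rw [integral_const_mul, integral_const_mul, ← mul_sub] at h1 h2
  rw [h] at h1 h3
  have h4 := h2.trans h3
  rw [inv_mul_le_iff₀ hK, mul_zero] at h1 h4
  linarith

theorem Prob.eq_of_krDist_eq_zero {η η' : Prob Z} (h : krDist η η' = 0) : η = η' := by
  suffices hm : η.toMeasure = η'.toMeasure by
    cases η; cases η'; simpa using hm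
  refine ext_of_generate_finite {s : Set Z | IsClosed s} ?_ isPiSystem_isClosed ?_ (by simp)
  · rw [BorelSpace.measurable_eq (α := Z), borel_eq_generateFrom_isClosed]
  · intro s hs
    have hδ : ∀ n : ℕ, (0 : ℝ) < 1 / ((n : ℝ) + 1) := fun n => by positivity
    have ht : Tendsto (fun n : ℕ => (1 : ℝ) / ((n : ℝ) + 1)) atTop (𝓝 0) :=
      tendsto_one_div_add_atTop_nhds_zero_nat
    refine tendsto_nhds_unique
      (tendsto_lintegral_thickenedIndicator_of_isClosed η.toMeasure hs hδ ht) ?_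
    have key := tendsto_lintegral_thickenedIndicator_of_isClosed η'.toMeasure hs hδ ht
    refine key.congr fun n => ?_
    have hl := lipschitzWith_thickenedIndicator (hδ n) s
    have hl' : LipschitzWith (1 / ((n : ℝ) + 1)).toNNReal⁻¹
        (fun z => (thickenedIndicator (hδ n) s z : ℝ)) := by
      have := NNReal.isometry_coe.lipschitz.comp hl
      rwa [one_mul] at this
    have e := integral_eq_of_krDist_eq_zero h hl'
    have conv : ∀ ζ : Prob Z, ∫⁻ z, (thickenedIndicator (hδ n) s z : ℝ≥0∞) ∂ζ.toMeasure =
        ENNReal.ofReal (∫ z, (thickenedIndicator (hδ n) s z : ℝ) ∂ζ.toMeasure) := fun ζ => by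
      rw [ofReal_integral_eq_lintegral_ofReal (ζ.integrable_of_continuous hl'.continuous)
        (Eventually.of_forall fun z => NNReal.coe_nonneg _)]
      simp
    rw [conv η, conv η', e]

/-- `Δ(Z)` as a metric space, for a compact metric space `Z`. -/
noncomputable instance : MetricSpace (Prob Z) where
  dist := krDist
  dist_self η := le_antisymm (krDist_le fun f _ => by simp)
    (by simpa using integral_sub_le_krDist η η (f := fun _ => (0 : ℝ)) (LipschitzWith.const' 0))
  dist_comm η η' := le_antisymm (krDist_comm_le _ _) (krDist_comm_le _ _)
  dist_triangle η₁ η₂ η₃ := krDist_le fun f hf => by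
    have h1 := integral_sub_le_krDist η₁ η₂ hf
    have h2 := integral_sub_le_krDist η₂ η₃ hf
    linarith
  eq_of_dist_eq_zero h := Prob.eq_of_krDist_eq_zero h

/-- `Δ(Z)` carries the Borel σ-algebra of the Kantorovich-Rubinstein metric. -/
noncomputable instance : MeasurableSpace (Prob Z) := borel _

instance : BorelSpace (Prob Z) := ⟨rfl⟩

end KantorovichRubinstein

variable {X Y : Type*} [MetricSpace X] [CompactSpace X] [MeasurableSpace X] [BorelSpace X]
  [MetricSpace Y] [CompactSpace Y] [MeasurableSpace Y] [BorelSpace Y]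

/-- `Lip(Z)`: Lipschitz real-valued functions, with some constant. -/
def IsLip {Z : Type*} [MetricSpace Z] (f : Z → ℝ) : Prop := ∃ L : ℝ≥0, LipschitzWith L f

/-- `γ` is an assignment: its marginal over `X` is `μ` and the average workforce
`B ↦ ∫ η(B) dγ(x, η)` is `ν`. -/
def IsAssignment (μ : Prob X) (ν : Prob Y) (γ : Prob (X × Prob Y)) : Prop :=
  γ.toMeasure.map Prod.fst = μ.toMeasure ∧
    ∀ B : Set Y, MeasurableSet B → ∫⁻ z, z.2.toMeasure B ∂γ.toMeasure = ν.toMeasure B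

/-- No firm-workforce pair `(x, η)` generates more value than `p(x) + E_η[q]`. -/
def NoEntry (V : X × Prob Y → ℝ) (p : X → ℝ) (q : Y → ℝ) : Prop :=
  ∀ (x : X) (η : Prob Y), V (x, η) ≤ p x + ∫ y, q y ∂η.toMeasure

/-- `(γ; p, q)` is a competitive equilibrium. -/
def IsEquilibrium (V : X × Prob Y → ℝ) (μ : Prob X) (ν : Prob Y)
    (γ : Prob (X × Prob Y)) (p : X → ℝ) (q : Y → ℝ) : Prop :=
  IsAssignment μ ν γ ∧ IsLip p ∧ IsLip q ∧
    (∀ (x : X) (η : Prob Y), (x, η) ∈ γ.toMeasure.support →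
      p x + ∫ y, q y ∂η.toMeasure = V (x, η)) ∧
    NoEntry V p q

/-- The planner's objective `E_γ[V]`. -/
noncomputable def primalValue (V : X × Prob Y → ℝ) (γ : Prob (X × Prob Y)) : ℝ :=
  ∫ z, V z ∂γ.toMeasure

/-- The dual objective `E_μ[p] + E_ν[q]`. -/
noncomputable def dualValue (μ : Prob X) (ν : Prob Y) (p : X → ℝ) (q : Y → ℝ) : ℝ :=
  ∫ x, p x ∂μ.toMeasure + ∫ y, q y ∂ν.toMeasure

/-- `γ` solves the planner's problem: it maximizes `E_γ[V]` among all assignments. -/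
def SolvesPrimal (V : X × Prob Y → ℝ) (μ : Prob X) (ν : Prob Y)
    (γ : Prob (X × Prob Y)) : Prop :=
  IsAssignment μ ν γ ∧
    ∀ γ' : Prob (X × Prob Y), IsAssignment μ ν γ' → primalValue V γ' ≤ primalValue V γ

/-- `(p, q)` solves the dual problem: it minimizes `E_μ[p] + E_ν[q]` among all pairs of Lipschitz
functions that satisfy the no-entry condition. -/
def SolvesDual (V : X × Prob Y → ℝ) (μ : Prob X) (ν : Prob Y) (p : X → ℝ) (q : Y → ℝ) : Prop :=
  IsLip p ∧ IsLip q ∧ NoEntry V p q ∧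
    ∀ (p' : X → ℝ) (q' : Y → ℝ), IsLip p' → IsLip q' → NoEntry V p' q' →
      dualValue μ ν p q ≤ dualValue μ ν p' q'

end Matching

set_option linter.unusedSectionVars false

/-! Under an assignment, p(x) + E_η[q] integrates to E_μ[p] + E_ν[q]. Hence E_γ[V] is at most the
dual value of any feasible (p, q), with equality iff the constraint binds γ-almost everywhere, that
is, by continuity, on the support. Equilibria are thus the pairs of solutions, once there is no
duality gap and the dual infimum is attained.

No gap (`exists_isAssignment_primalValue_eq_dualInf`): the dual infimum is sublinear in the value
function. Hahn–Banach gives a linear functional below it that touches it at V. Domination makes this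
functional positive and fixes its values on the functions p + E[q], so its Riesz measure is an
assignment.

Attainment (`exists_solvesDual`): wages can be made L-Lipschitz at cost ε, with L the constant of V
(`NoEntry.exists_lipschitz_wage`). The profit function inherits L, a constant shift bounds the
wages, and Arzelà–Ascoli gives compactness. -/

namespace Matching

/-! ### Topology and measurability of Δ(Z). -/

section Prob

variable {Z : Type*} [MetricSpace Z] [CompactSpace Z] [MeasurableSpace Z] [BorelSpace Z]

theorem Prob.eq_of_integral_lipschitz_eq {η η' : Prob Z}
    (h : ∀ f : Z → ℝ, IsLip f → ∫ z, f z ∂η.toMeasure = ∫ z, f z ∂η'.toMeasure) : η = η' := by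
  refine eq_of_dist_eq_zero (le_antisymm (krDist_le fun f hf => ?_) dist_nonneg)
  rw [h f ⟨1, hf⟩, sub_self]

/-- Integrating a Lipschitz function is Lipschitz for the Kantorovich-Rubinstein distance. -/
theorem Prob.integral_le_add_dist {K : ℝ≥0} {f : Z → ℝ} (hf : LipschitzWith K f) (η η' : Prob Z) :
    ∫ z, f z ∂η.toMeasure ≤ ∫ z, f z ∂η'.toMeasure + K * dist η η' := by
  -- Rescaling by c > K rather than by K avoids dividing by zero when K = 0; then c decreases to K.
  have key : ∀ c : ℝ, K < c →
      ∫ z, f z ∂η.toMeasure - ∫ z, f z ∂η'.toMeasure ≤ c * dist η η' := by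
    intro c hc
    have hc0 : 0 < c := K.coe_nonneg.trans_lt hc
    have hg : LipschitzWith 1 (fun z => c⁻¹ * f z) := by
      refine LipschitzWith.of_dist_le_mul fun x y => ?_
      have h1 := hf.dist_le_mul x y
      rw [Real.dist_eq] at h1 ⊢
      rw [← mul_sub, abs_mul, abs_of_pos (inv_pos.2 hc0), NNReal.coe_one, one_mul,
        inv_mul_le_iff₀ hc0]
      exact h1.trans (mul_le_mul_of_nonneg_right hc.le dist_nonneg)
    have h1 := integral_sub_le_krDist η η' hg
    rwa [integral_const_mul, integral_const_mul, ← mul_sub, inv_mul_le_iff₀ hc0] at h1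
  have ht : Tendsto (fun c : ℝ => c * dist η η') (𝓝[>] (K : ℝ)) (𝓝 (K * dist η η')) :=
    ((continuous_id.mul continuous_const).tendsto _).mono_left nhdsWithin_le_nhds
  have := ge_of_tendsto ht (eventually_mem_nhdsWithin.mono fun c hc => key c hc)
  linarith

theorem Prob.lipschitzWith_integral {K : ℝ≥0} {f : Z → ℝ} (hf : LipschitzWith K f) :
    LipschitzWith K (fun η : Prob Z => ∫ z, f z ∂η.toMeasure) :=
  LipschitzWith.of_le_add_mul K fun η η' => integral_le_add_dist hf η η'

/-- The mass of a closed set is the limit of integrals of Lipschitz thickened indicators, each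
continuous in η. Closed sets generate the σ-algebra. -/
theorem Prob.measurable_toMeasure : Measurable (Prob.toMeasure : Prob Z → Measure Z) := by
  refine Measurable.measure_of_isPiSystem_of_isProbabilityMeasure (S := {s : Set Z | IsClosed s})
    ?_ isPiSystem_isClosed fun s hs => ?_
  · rw [BorelSpace.measurable_eq (α := Z), borel_eq_generateFrom_isClosed]
  · have hδ : ∀ n : ℕ, (0 : ℝ) < 1 / ((n : ℝ) + 1) := fun n => by positivity
    have ht : Tendsto (fun n : ℕ => (1 : ℝ) / ((n : ℝ) + 1)) atTop (𝓝 0) :=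
      tendsto_one_div_add_atTop_nhds_zero_nat
    refine measurable_of_tendsto_metrizable
      (f := fun (n : ℕ) (η : Prob Z) => ∫⁻ z, (thickenedIndicator (hδ n) s z : ℝ≥0∞) ∂η.toMeasure)
      (fun n => ?_) (tendsto_pi_nhds.2 fun η =>
        tendsto_lintegral_thickenedIndicator_of_isClosed η.toMeasure hs hδ ht)
    have hl : LipschitzWith (1 / ((n : ℝ) + 1)).toNNReal⁻¹
        (fun z => (thickenedIndicator (hδ n) s z : ℝ)) := by
      have := NNReal.isometry_coe.lipschitz.comp (lipschitzWith_thickenedIndicator (hδ n) s)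
      rwa [one_mul] at this
    have e : (fun η : Prob Z => ∫⁻ z, (thickenedIndicator (hδ n) s z : ℝ≥0∞) ∂η.toMeasure) =
        fun η => ENNReal.ofReal (∫ z, (thickenedIndicator (hδ n) s z : ℝ) ∂η.toMeasure) := by
      funext η
      rw [ofReal_integral_eq_lintegral_ofReal (η.integrable_of_continuous hl.continuous)
        (Eventually.of_forall fun z => NNReal.coe_nonneg _)]
      simp
    rw [e]
    exact (ENNReal.continuous_ofReal.comp (lipschitzWith_integral hl).continuous).measurable

/-- Functions that are `K`-Lipschitz and bounded by `D`. -/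
def lipschitzBall (Z : Type*) [MetricSpace Z] (K : ℝ≥0) (D : ℝ) :
    Set (BoundedContinuousFunction Z ℝ) :=
  {f | LipschitzWith K f ∧ ∀ z, f z ∈ Icc (-D) D}

theorem isCompact_lipschitzBall (K : ℝ≥0) (D : ℝ) : IsCompact (lipschitzBall Z K D) := by
  refine BoundedContinuousFunction.arzela_ascoli₂ (Icc (-D) D) isCompact_Icc _ ?_
    (fun f z hf => hf.2 z) ?_
  · have hev : ∀ z : Z, Continuous fun f : BoundedContinuousFunction Z ℝ => f z :=
      fun z => continuous_eval_const z
    have : lipschitzBall Z K D = (⋂ z : Z, ⋂ w : Z, {f | dist (f z) (f w) ≤ K * dist z w}) ∩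
        ⋂ z : Z, {f | f z ∈ Icc (-D) D} := by
      ext f
      simp [lipschitzBall, lipschitzWith_iff_dist_le_mul]
    rw [this]
    refine (isClosed_iInter fun z => isClosed_iInter fun w => ?_).inter (isClosed_iInter fun z => ?_)
    · exact isClosed_le ((hev z).dist (hev w)) continuous_const
    · exact isClosed_Icc.preimage (hev z)
  · exact (LipschitzWith.uniformEquicontinuous _ K fun f => f.2.1).equicontinuous

theorem Prob.continuous_integral_boundedContinuous (η : Prob Z) :
    Continuous fun f : BoundedContinuousFunction Z ℝ => ∫ z, f z ∂η.toMeasure := by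
  refine (LipschitzWith.of_le_add_mul 1 fun f g => ?_).continuous
  have h : ∫ z, f z ∂η.toMeasure ≤ ∫ z, (g z + dist f g) ∂η.toMeasure :=
    integral_mono (η.integrable_of_continuous f.continuous)
      ((η.integrable_of_continuous g.continuous).add (integrable_const _)) fun z => by
        have h1 := BoundedContinuousFunction.dist_coe_le_dist (f := f) (g := g) z
        have h2 := le_abs_self (f z - g z)
        rw [Real.dist_eq] at h1
        simp only
        linarith
  rw [integral_add (η.integrable_of_continuous g.continuous) (integrable_const _)] at h
  simpa using h

/-- Weak convergence implies convergence in the Kantorovich-Rubinstein distance. -/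
theorem Prob.continuous_of_probabilityMeasure :
    Continuous fun η : ProbabilityMeasure Z => (⟨η, inferInstance⟩ : Prob Z) := by
  rw [continuous_iff_continuousAt]
  intro η₀
  refine Metric.tendsto_nhds.2 fun ε hε => ?_
  obtain ⟨z₀⟩ : Nonempty Z := (η₀ : Measure Z).nonempty_of_neZero
  -- A finite net reduces uniformity over all 1-Lipschitz functions to finitely many weak limits.
  -- Two approximations and one limit cost ε/4 each.
  obtain ⟨t, -, htf, ht⟩ := (isCompact_lipschitzBall (Z := Z) 1
    (Metric.diam (univ : Set Z))).finite_cover_balls (e := ε / 4) (by positivity)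
  have hev : ∀ᶠ η : ProbabilityMeasure Z in 𝓝 η₀, ∀ g ∈ t,
      dist (∫ z, g z ∂(η : Measure Z)) (∫ z, g z ∂(η₀ : Measure Z)) < ε / 4 := by
    rw [eventually_all_finite htf]
    intro g _
    exact Metric.tendsto_nhds.1
      (ProbabilityMeasure.tendsto_iff_forall_integral_tendsto.1 tendsto_id g) _ (by positivity)
  filter_upwards [hev] with η hη
  refine lt_of_le_of_lt (b := 3 * (ε / 4)) (krDist_le fun f hf => ?_) (by linarith)
  -- Subtracting f z₀ bounds the function by the diameter and leaves differences of integrals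
  -- unchanged.
  let g : BoundedContinuousFunction Z ℝ :=
    BoundedContinuousFunction.mkOfCompact ⟨fun z => f z - f z₀, hf.continuous.sub continuous_const⟩
  have hg : g ∈ lipschitzBall Z 1 (Metric.diam (univ : Set Z)) := by
    refine ⟨LipschitzWith.of_dist_le_mul fun z w => ?_, fun z => ?_⟩
    · simpa [g] using hf.dist_le_mul z w
    · have h1 := hf.dist_le_mul z z₀
      have h2 := Metric.dist_le_diam_of_mem (isCompact_univ (X := Z)).isBounded
        (mem_univ z) (mem_univ z₀)
      rw [Real.dist_eq, NNReal.coe_one, one_mul] at h1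
      exact abs_le.1 (h1.trans h2)
  obtain ⟨k, hk, hgk⟩ := mem_iUnion₂.1 (ht hg)
  have close : ∀ ζ : ProbabilityMeasure Z,
      |∫ z, g z ∂(ζ : Measure Z) - ∫ z, k z ∂(ζ : Measure Z)| ≤ ε / 4 := by
    intro ζ
    have hi : ∀ u : BoundedContinuousFunction Z ℝ, Integrable u (ζ : Measure Z) :=
      fun u => Prob.integrable_of_continuous ⟨ζ, inferInstance⟩ u.continuous
    rw [← integral_sub (hi g) (hi k)]
    have := norm_integral_le_of_norm_le_const (μ := (ζ : Measure Z)) (f := fun z => g z - k z)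
      (C := ε / 4) (Eventually.of_forall fun z => by
        have := BoundedContinuousFunction.dist_coe_le_dist (f := g) (g := k) z
        rw [Real.dist_eq] at this
        exact this.trans (Metric.mem_ball.1 hgk).le)
    simpa using this
  have shift : ∀ ζ : ProbabilityMeasure Z,
      ∫ z, f z ∂(ζ : Measure Z) = ∫ z, g z ∂(ζ : Measure Z) + f z₀ := by
    intro ζ
    have : ∫ z, g z ∂(ζ : Measure Z) = ∫ z, (f z - f z₀) ∂(ζ : Measure Z) := rfl
    rw [this, integral_sub (Prob.integrable_of_continuous ⟨ζ, inferInstance⟩ hf.continuous)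
      (integrable_const _)]
    simp
  have h1 := abs_le.1 (close η)
  have h2 := abs_le.1 (close η₀)
  have h3 := hη k hk
  rw [Real.dist_eq] at h3
  have h4 := abs_lt.1 h3
  simp only [shift]
  linarith

instance : CompactSpace (Prob Z) := by
  have hs : Function.Surjective fun η : ProbabilityMeasure Z => (⟨η, inferInstance⟩ : Prob Z) :=
    fun η => ⟨⟨η.toMeasure, inferInstance⟩, rfl⟩
  exact hs.compactSpace Prob.continuous_of_probabilityMeasure

end Prob

/-! ### Assignments, weak duality and complementary slackness. -/

section Assignment

variable {X Y : Type*} [MetricSpace X] [CompactSpace X] [MeasurableSpace X] [BorelSpace X]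
  [MetricSpace Y] [CompactSpace Y] [MeasurableSpace Y] [BorelSpace Y]

theorem IsLip.continuous {Z : Type*} [MetricSpace Z] {f : Z → ℝ} (hf : IsLip f) : Continuous f :=
  hf.choose_spec.continuous

theorem IsLip.add {Z : Type*} [MetricSpace Z] {f g : Z → ℝ} (hf : IsLip f) (hg : IsLip g) :
    IsLip fun z => f z + g z :=
  ⟨_, hf.choose_spec.add hg.choose_spec⟩

theorem IsLip.const_mul {Z : Type*} [MetricSpace Z] {f : Z → ℝ} (hf : IsLip f) (c : ℝ) :
    IsLip fun z => c * f z := by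
  obtain ⟨K, hK⟩ := hf
  refine ⟨‖c‖₊ * K, LipschitzWith.of_dist_le_mul fun x y => ?_⟩
  rw [Real.dist_eq, ← mul_sub, abs_mul, NNReal.coe_mul, coe_nnnorm, Real.norm_eq_abs, mul_assoc]
  exact mul_le_mul_of_nonneg_left (hK.dist_le_mul x y) (abs_nonneg c)

theorem IsLip.const {Z : Type*} [MetricSpace Z] (c : ℝ) : IsLip fun _ : Z => c :=
  ⟨0, LipschitzWith.const c⟩

theorem IsLip.continuous_integral {q : Y → ℝ} (hq : IsLip q) :
    Continuous fun η : Prob Y => ∫ y, q y ∂η.toMeasure :=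
  (Prob.lipschitzWith_integral hq.choose_spec).continuous

/-- The firms' marginal of a measure on firm-workforce pairs. -/
noncomputable def Prob.fst (γ : Prob (X × Prob Y)) : Prob X :=
  ⟨γ.toMeasure.map Prod.fst, Measure.isProbabilityMeasure_map measurable_fst.aemeasurable⟩

/-- The kernel that sends a firm-workforce pair to its workforce. -/
noncomputable def workforceKernel (X Y : Type*)
    [MeasurableSpace X] [MetricSpace Y] [CompactSpace Y] [MeasurableSpace Y] [BorelSpace Y] :
    ProbabilityTheory.Kernel (X × Prob Y) Y :=
  ⟨fun z => z.2.toMeasure, Prob.measurable_toMeasure.comp measurable_snd⟩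

instance : ProbabilityTheory.IsMarkovKernel (workforceKernel X Y) :=
  ⟨fun z => z.2.isProb⟩

/-- The average workforce of a measure on firm-workforce pairs. -/
noncomputable def Prob.average (γ : Prob (X × Prob Y)) : Prob Y :=
  ⟨γ.toMeasure.bind (workforceKernel X Y), inferInstance⟩

theorem Prob.integral_fst (γ : Prob (X × Prob Y)) {p : X → ℝ} (hp : Continuous p) :
    ∫ x, p x ∂γ.fst.toMeasure = ∫ z, p z.1 ∂γ.toMeasure :=
  integral_map measurable_fst.aemeasurable hp.aestronglyMeasurable

theorem Prob.integral_average (γ : Prob (X × Prob Y)) {q : Y → ℝ} (hq : Continuous q) :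
    ∫ y, q y ∂γ.average.toMeasure = ∫ z, ∫ y, q y ∂z.2.toMeasure ∂γ.toMeasure :=
  -- Viewed as a kernel from a point, γ makes the average workforce a composition of kernels.
  ProbabilityTheory.Kernel.integral_comp (κ := ProbabilityTheory.Kernel.const Unit γ.toMeasure)
    (η := workforceKernel X Y) (a := ()) (γ.average.integrable_of_continuous hq)

theorem Prob.toMeasure_injective {Z : Type*} [MeasurableSpace Z] :
    Function.Injective (Prob.toMeasure : Prob Z → Measure Z) := by
  rintro ⟨η, _⟩ ⟨η', _⟩ h
  simpa using h

/-- Stated as equalities in Δ(X) and Δ(Y), both constraints can be tested on Lipschitz functions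
alone. -/
theorem isAssignment_iff {μ : Prob X} {ν : Prob Y} {γ : Prob (X × Prob Y)} :
    IsAssignment μ ν γ ↔ γ.fst = μ ∧ γ.average = ν := by
  rw [← Prob.toMeasure_injective.eq_iff, ← Prob.toMeasure_injective.eq_iff,
    Measure.ext_iff (μ₁ := γ.average.toMeasure)]
  refine and_congr Iff.rfl (forall₂_congr fun B hB => ?_)
  have : γ.average.toMeasure B = ∫⁻ z, z.2.toMeasure B ∂γ.toMeasure :=
    Measure.bind_apply hB (workforceKernel X Y).aemeasurable
  rw [this]

theorem IsAssignment.integral_add_eq_dualValue {μ : Prob X} {ν : Prob Y} {γ : Prob (X × Prob Y)}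
    (hγ : IsAssignment μ ν γ) {p : X → ℝ} {q : Y → ℝ} (hp : IsLip p) (hq : IsLip q) :
    ∫ z, (p z.1 + ∫ y, q y ∂z.2.toMeasure) ∂γ.toMeasure = dualValue μ ν p q := by
  obtain ⟨rfl, rfl⟩ := isAssignment_iff.1 hγ
  rw [dualValue, γ.integral_fst hp.continuous, γ.integral_average hq.continuous]
  exact integral_add (γ.integrable_of_continuous (hp.continuous.comp continuous_fst))
    (γ.integrable_of_continuous (hq.continuous_integral.comp continuous_snd))

theorem IsAssignment.primalValue_le_dualValue {μ : Prob X} {ν : Prob Y} {γ : Prob (X × Prob Y)}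
    (hγ : IsAssignment μ ν γ) {V : X × Prob Y → ℝ} (hV : Continuous V) {p : X → ℝ} {q : Y → ℝ}
    (hp : IsLip p) (hq : IsLip q) (h : NoEntry V p q) :
    primalValue V γ ≤ dualValue μ ν p q := by
  rw [← hγ.integral_add_eq_dualValue hp hq]
  exact integral_mono (γ.integrable_of_continuous hV) (γ.integrable_of_continuous
    ((hp.continuous.comp continuous_fst).add (hq.continuous_integral.comp continuous_snd)))
    fun z => h z.1 z.2

/-- Complementary slackness: an assignment and a feasible pair of prices form an equilibrium iff
their values agree. -/
theorem IsAssignment.isEquilibrium_iff {μ : Prob X} {ν : Prob Y} {γ : Prob (X × Prob Y)}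
    (hγ : IsAssignment μ ν γ) {V : X × Prob Y → ℝ} (hV : Continuous V) {p : X → ℝ} {q : Y → ℝ}
    (hp : IsLip p) (hq : IsLip q) (h : NoEntry V p q) :
    IsEquilibrium V μ ν γ p q ↔ primalValue V γ = dualValue μ ν p q := by
  have hcont : Continuous fun z : X × Prob Y => p z.1 + ∫ y, q y ∂z.2.toMeasure :=
    (hp.continuous.comp continuous_fst).add (hq.continuous_integral.comp continuous_snd)
  have hiff : primalValue V γ = dualValue μ ν p q ↔
      V =ᵐ[γ.toMeasure] fun z => p z.1 + ∫ y, q y ∂z.2.toMeasure := by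
    rw [← hγ.integral_add_eq_dualValue hp hq]
    exact integral_eq_iff_of_ae_le (γ.integrable_of_continuous hV)
      (γ.integrable_of_continuous hcont) (Eventually.of_forall fun z => h z.1 z.2)
  rw [hiff]
  constructor
  · rintro ⟨-, -, -, hs, -⟩
    filter_upwards [Measure.support_mem_ae (μ := γ.toMeasure)] with z hz
    exact (hs z.1 z.2 hz).symm
  · intro hae
    refine ⟨hγ, hp, hq, fun x η hx => ?_, h⟩
    -- The set where V equals p + E[q] is closed and of full measure, so it contains the support.
    have := Measure.support_subset_of_isClosed (isClosed_eq hV hcont) hae hx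
    exact Eq.symm this

end Assignment

/-! ### Attainment in the dual problem. -/

section Dual

variable {X Y : Type*} [MetricSpace X] [CompactSpace X]
  [MetricSpace Y] [CompactSpace Y] [MeasurableSpace Y] [BorelSpace Y]

/-- Over a finite set, minimizers can be selected measurably. -/
theorem exists_measurable_argmin {W Z : Type*} [MeasurableSpace W] [MeasurableSpace Z]
    {F : W → Z → ℝ} (hF : Measurable (Function.uncurry F)) {t : Finset Z} (ht : t.Nonempty) :
    ∃ s : W → Z, Measurable s ∧ ∀ y, s y ∈ t ∧ ∀ i ∈ t, F y (s y) ≤ F y i := by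
  classical
  induction ht using Finset.Nonempty.cons_induction with
  | singleton a => exact ⟨fun _ => a, measurable_const, by simp⟩
  | cons a t ha ht ih =>
    obtain ⟨s, hs, h⟩ := ih
    refine ⟨fun y => if F y a ≤ F y (s y) then a else s y,
      Measurable.ite (measurableSet_le (hF.comp (measurable_id.prodMk measurable_const))
        (hF.comp (measurable_id.prodMk hs))) measurable_const hs, fun y => ?_⟩
    dsimp only
    split_ifs with hy
    · refine ⟨by simp, fun i hi => ?_⟩
      rcases Finset.mem_cons.1 hi with rfl | hi
      · exact le_rfl
      · exact hy.trans ((h y).2 i hi)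
    · refine ⟨Finset.mem_cons_of_mem (h y).1, fun i hi => ?_⟩
      rcases Finset.mem_cons.1 hi with rfl | hi
      · exact (not_le.1 hy).le
      · exact (h y).2 i hi

/-- Transporting each y to s y bounds the gain of every 1-Lipschitz test function pointwise. -/
theorem Prob.dist_map_le (η : Prob Y) {s : Y → Y} (hs : Measurable s) :
    dist η ⟨η.toMeasure.map s, Measure.isProbabilityMeasure_map hs.aemeasurable⟩ ≤
      ∫ y, dist y (s y) ∂η.toMeasure := by
  refine krDist_le fun f hf => ?_
  have hd : Integrable (fun y => dist y (s y)) η.toMeasure :=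
    Integrable.of_bound (measurable_id.dist hs).aestronglyMeasurable
      (Metric.diam (univ : Set Y)) (Eventually.of_forall fun y => by
        rw [Real.norm_of_nonneg dist_nonneg]
        exact Metric.dist_le_diam_of_mem isCompact_univ.isBounded (mem_univ _) (mem_univ _))
  let η' : Prob Y := ⟨η.toMeasure.map s, Measure.isProbabilityMeasure_map hs.aemeasurable⟩
  have hfs : Integrable (fun y => f (s y)) η.toMeasure :=
    (η'.integrable_of_continuous hf.continuous).comp_measurable hs
  rw [integral_map hs.aemeasurable hf.continuous.aestronglyMeasurable,
    ← integral_sub (η.integrable_of_continuous hf.continuous) hfs]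
  refine integral_mono ((η.integrable_of_continuous hf.continuous).sub hfs) hd fun y => ?_
  have := hf.dist_le_mul y (s y)
  rw [NNReal.coe_one, one_mul, Real.dist_eq] at this
  exact (le_abs_self _).trans this

/-- Wages can be replaced by wages with the Lipschitz constant of the value function, at an
arbitrarily small cost. -/
theorem NoEntry.exists_lipschitz_wage {L : ℝ≥0} {V : X × Prob Y → ℝ} (hV : LipschitzWith L V)
    {p : X → ℝ} {q : Y → ℝ} (hq : IsLip q) (h : NoEntry V p q) {ε : ℝ} (hε : 0 < ε) :
    ∃ q' : Y → ℝ, LipschitzWith L q' ∧ NoEntry V p q' ∧ ∀ y, q' y ≤ q y + ε := by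
  rcases isEmpty_or_nonempty Y with hY | ⟨⟨y₀⟩⟩
  · exact ⟨q, LipschitzWith.of_dist_le_mul fun y => hY.elim y, h, fun y => hY.elim y⟩
  obtain ⟨M, hM⟩ := hq
  have hq := hM.continuous
  -- Using a net point near y instead of y costs at most (M + L)δ ≤ ε; the 1 keeps the denominator
  -- positive.
  set δ : ℝ := ε / (M + L + 1)
  have hML : (0 : ℝ) < M + L + 1 := by positivity
  have hδ : 0 < δ := by positivity
  obtain ⟨t, -, htf, hcov⟩ := (isCompact_univ (X := Y)).finite_cover_balls hδ
  have hnet : ∀ y, ∃ i ∈ htf.toFinset, dist y i < δ := fun y => by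
    obtain ⟨i, hi, hy⟩ := mem_iUnion₂.1 (hcov (mem_univ y))
    exact ⟨i, htf.mem_toFinset.2 hi, hy⟩
  have hne : htf.toFinset.Nonempty := (hnet y₀).imp fun _ h => h.1
  obtain ⟨s, hs, hmin⟩ := exists_measurable_argmin
    (F := fun y i : Y => q i + L * dist y i) (by
      have : Continuous (Function.uncurry fun y i : Y => q i + L * dist y i) := by
        simp only [Function.uncurry_def]
        fun_prop
      exact this.measurable) hne
  -- This is the infimal convolution of q with L · dist over the net, a minimum of L-Lipschitz
  -- functions.
  refine ⟨fun y => q (s y) + L * dist y (s y), LipschitzWith.of_le_add_mul L fun y y' => ?_,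
    fun x η => ?_, fun y => ?_⟩
  · have h1 := (hmin y).2 (s y') (hmin y').1
    have h2 := mul_le_mul_of_nonneg_left (dist_triangle y y' (s y')) L.coe_nonneg
    linarith
  · let η' : Prob Y := ⟨η.toMeasure.map s, Measure.isProbabilityMeasure_map hs.aemeasurable⟩
    have hd : Integrable (fun y => dist y (s y)) η.toMeasure :=
      Integrable.of_bound (measurable_id.dist hs).aestronglyMeasurable
        (Metric.diam (univ : Set Y)) (Eventually.of_forall fun y => by
          rw [Real.norm_of_nonneg dist_nonneg]
          exact Metric.dist_le_diam_of_mem isCompact_univ.isBounded (mem_univ _) (mem_univ _))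
    have hqs : Integrable (fun y => q (s y)) η.toMeasure :=
      (η'.integrable_of_continuous hq).comp_measurable hs
    rw [integral_add hqs (hd.const_mul _), integral_const_mul]
    have h1 : ∫ y, q y ∂η'.toMeasure = ∫ y, q (s y) ∂η.toMeasure :=
      integral_map hs.aemeasurable hq.aestronglyMeasurable
    have h2 := h x η'
    have h3 := mul_le_mul_of_nonneg_left (η.dist_map_le hs) L.coe_nonneg
    have h4 := hV.dist_le_mul (x, η) (x, η')
    have h5 : dist (x, η) (x, η') = dist η η' := by simp [Prod.dist_eq]
    rw [h5, Real.dist_eq] at h4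
    have h6 := le_abs_self (V (x, η) - V (x, η'))
    have h7 : (L : ℝ) * dist η η' ≤ L * ∫ y, dist y (s y) ∂η.toMeasure := h3
    linarith
  · obtain ⟨i, hi, hy⟩ := hnet y
    have h1 := (hmin y).2 i hi
    have h2 := hM.dist_le_mul i y
    rw [Real.dist_eq, dist_comm] at h2
    have h3 := le_abs_self (q i - q y)
    have h4 : (M + L + 1 : ℝ) * δ = ε := by simp only [δ]; field_simp
    have h5 := mul_le_mul_of_nonneg_left hy.le M.coe_nonneg
    have h6 := mul_le_mul_of_nonneg_left hy.le L.coe_nonneg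
    simp only
    nlinarith

/-- The highest profit that a firm can make at given wages. -/
noncomputable def profit (V : X × Prob Y → ℝ) (q : Y → ℝ) (x : X) : ℝ :=
  ⨆ η : Prob Y, (V (x, η) - ∫ y, q y ∂η.toMeasure)

theorem le_profit {V : X × Prob Y → ℝ} (hV : Continuous V) {q : Y → ℝ} (hq : IsLip q)
    (x : X) (η : Prob Y) : V (x, η) - ∫ y, q y ∂η.toMeasure ≤ profit V q x := by
  refine le_ciSup (f := fun η : Prob Y => V (x, η) - ∫ y, q y ∂η.toMeasure) ?_ η
  exact (isCompact_range ((hV.comp (Continuous.prodMk_right x)).sub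
    hq.continuous_integral)).bddAbove

theorem noEntry_profit {V : X × Prob Y → ℝ} (hV : Continuous V) {q : Y → ℝ} (hq : IsLip q) :
    NoEntry V (profit V q) q := fun x η => by
  have := le_profit hV hq x η
  linarith

theorem NoEntry.profit_le [Nonempty (Prob Y)] {V : X × Prob Y → ℝ} {p : X → ℝ} {q : Y → ℝ}
    (h : NoEntry V p q) (x : X) : profit V q x ≤ p x :=
  ciSup_le fun η => by
    have := h x η
    linarith

/-- A supremum of functions of x that are all L-Lipschitz is L-Lipschitz. -/
theorem lipschitzWith_profit [Nonempty (Prob Y)] {L : ℝ≥0} {V : X × Prob Y → ℝ}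
    (hV : LipschitzWith L V) {q : Y → ℝ} (hq : IsLip q) : LipschitzWith L (profit V q) := by
  refine LipschitzWith.of_le_add_mul L fun x x' => ciSup_le fun η => ?_
  have h1 := le_profit hV.continuous hq x' η
  have h2 := hV.dist_le_mul (x, η) (x', η)
  have h3 : dist (x, η) (x', η) = dist x x' := by simp [Prod.dist_eq]
  rw [h3, Real.dist_eq] at h2
  have := le_abs_self (V (x, η) - V (x', η))
  linarith

theorem Prob.abs_integral_le (η : Prob Y) {f : Y → ℝ} {C : ℝ} (h : ∀ y, |f y| ≤ C) :
    |∫ y, f y ∂η.toMeasure| ≤ C := by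
  simpa using norm_integral_le_of_norm_le_const (μ := η.toMeasure) (f := f)
    (Eventually.of_forall h)

variable [MeasurableSpace X] [BorelSpace X]

/-- The dual problem has a solution. -/
theorem exists_solvesDual (μ : Prob X) (ν : Prob Y) {V : X × Prob Y → ℝ} (hV : IsLip V) :
    ∃ (p : X → ℝ) (q : Y → ℝ), SolvesDual V μ ν p q := by
  obtain ⟨L, hL⟩ := hV
  have hV := hL.continuous
  have : Nonempty (Prob Y) := ⟨ν⟩
  obtain ⟨y₀⟩ : Nonempty Y := ν.toMeasure.nonempty_of_neZero
  obtain ⟨C, hC⟩ := (isCompact_univ (X := X × Prob Y)).exists_bound_of_continuousOn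
    hV.continuousOn
  replace hC : ∀ z, |V z| ≤ C := fun z => hC z (mem_univ z)
  set D : ℝ := L * Metric.diam (univ : Set Y)
  -- Wages vanishing at y₀ are bounded by D, and then the profit, a supremum of V - E[q], by C + D.
  let F : Set (BoundedContinuousFunction X ℝ × BoundedContinuousFunction Y ℝ) :=
    (lipschitzBall X L (C + D) ×ˢ lipschitzBall Y L D) ∩ {f | NoEntry V f.1 f.2}
  have hF : IsCompact F := by
    refine ((isCompact_lipschitzBall _ _).prod (isCompact_lipschitzBall _ _)).inter_right ?_
    simp only [NoEntry, ofPred_forall]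
    refine isClosed_iInter fun x => isClosed_iInter fun η => isClosed_le continuous_const ?_
    exact ((continuous_eval_const x).comp continuous_fst).add
      (η.continuous_integral_boundedContinuous.comp continuous_snd)
  have hobj : Continuous fun f : BoundedContinuousFunction X ℝ × BoundedContinuousFunction Y ℝ =>
      dualValue μ ν f.1 f.2 :=
    (μ.continuous_integral_boundedContinuous.comp continuous_fst).add
      (ν.continuous_integral_boundedContinuous.comp continuous_snd)
  have key : ∀ (p : X → ℝ) (q : Y → ℝ), IsLip p → IsLip q → NoEntry V p q → ∀ ε > 0,
      ∃ f ∈ F, dualValue μ ν f.1 f.2 ≤ dualValue μ ν p q + ε := by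
    intro p q hp hq h ε hε
    obtain ⟨q₁, hq₁, hne, hle⟩ := h.exists_lipschitz_wage hL hq hε
    -- Moving c from wages to profits preserves feasibility and the dual value.
    set c := q₁ y₀
    have hq₂ : LipschitzWith L fun y => q₁ y - c := LipschitzWith.of_dist_le_mul fun y y' => by
      simpa using hq₁.dist_le_mul y y'
    have hint : ∀ η : Prob Y, ∫ y, (q₁ y - c) ∂η.toMeasure = ∫ y, q₁ y ∂η.toMeasure - c :=
      fun η => by
        rw [integral_sub (η.integrable_of_continuous hq₁.continuous) (integrable_const _)]
        simp
    have hne₂ : NoEntry V (fun x => p x + c) (fun y => q₁ y - c) := fun x η => by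
      rw [hint]
      have := hne x η
      linarith
    have hb : ∀ y, |q₁ y - c| ≤ D := fun y =>
      (hq₁.dist_le_mul y y₀).trans (mul_le_mul_of_nonneg_left
        (Metric.dist_le_diam_of_mem isCompact_univ.isBounded (mem_univ _) (mem_univ _))
        L.coe_nonneg)
    have hp₂ := lipschitzWith_profit hL ⟨L, hq₂⟩
    have hpb : ∀ x, |profit V (fun y => q₁ y - c) x| ≤ C + D := fun x => by
      refine abs_le.2 ⟨?_, ciSup_le fun η => ?_⟩
      · have h1 := le_profit hV ⟨L, hq₂⟩ x ν
        have h2 := abs_le.1 (ν.abs_integral_le hb)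
        have h3 := abs_le.1 (hC (x, ν))
        linarith
      · have h2 := abs_le.1 (η.abs_integral_le hb)
        have h3 := abs_le.1 (hC (x, η))
        linarith
    refine ⟨(BoundedContinuousFunction.mkOfCompact ⟨_, hp₂.continuous⟩,
      BoundedContinuousFunction.mkOfCompact ⟨_, hq₂.continuous⟩),
      ⟨⟨⟨hp₂, fun x => abs_le.1 (hpb x)⟩, ⟨hq₂, fun y => abs_le.1 (hb y)⟩⟩,
        noEntry_profit hV ⟨L, hq₂⟩⟩, ?_⟩
    have h1 : ∫ x, profit V (fun y => q₁ y - c) x ∂μ.toMeasure ≤ ∫ x, p x ∂μ.toMeasure + c := by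
      have : ∫ x, profit V (fun y => q₁ y - c) x ∂μ.toMeasure ≤ ∫ x, (p x + c) ∂μ.toMeasure :=
        integral_mono (μ.integrable_of_continuous hp₂.continuous)
          ((μ.integrable_of_continuous hp.continuous).add (integrable_const _)) hne₂.profit_le
      rw [integral_add (μ.integrable_of_continuous hp.continuous) (integrable_const _)] at this
      simpa using this
    have h2 : ∫ y, q₁ y ∂ν.toMeasure ≤ ∫ y, q y ∂ν.toMeasure + ε := by
      have : ∫ y, q₁ y ∂ν.toMeasure ≤ ∫ y, (q y + ε) ∂ν.toMeasure :=
        integral_mono (ν.integrable_of_continuous hq₁.continuous)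
          ((ν.integrable_of_continuous hq.continuous).add (integrable_const _)) hle
      rw [integral_add (ν.integrable_of_continuous hq.continuous) (integrable_const _)] at this
      simpa using this
    have h3 := hint ν
    change ∫ x, profit V (fun y => q₁ y - c) x ∂μ.toMeasure + ∫ y, (q₁ y - c) ∂ν.toMeasure ≤
      ∫ x, p x ∂μ.toMeasure + ∫ y, q y ∂ν.toMeasure + ε
    linarith
  have hne : F.Nonempty := by
    obtain ⟨f, hf, -⟩ := key (fun _ => C) (fun _ => 0) (.const C) (.const 0)
      (fun x η => by simpa using (abs_le.1 (hC (x, η))).2) 1 one_pos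
    exact ⟨f, hf⟩
  obtain ⟨f, hf, hmin⟩ := hF.exists_isMinOn hne hobj.continuousOn
  refine ⟨f.1, f.2, ⟨L, hf.1.1.1⟩, ⟨L, hf.1.2.1⟩, hf.2, fun p q hp hq h => ?_⟩
  refine le_of_forall_pos_le_add fun ε hε => ?_
  obtain ⟨g, hg, hgle⟩ := key p q hp hq h ε hε
  exact (hmin hg).trans hgle

end Dual

/-! ### The dual infimum as a sublinear functional, and absence of a gap. -/

section StrongDuality

variable {X Y : Type*} [MetricSpace X] [CompactSpace X] [MeasurableSpace X] [BorelSpace X]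
  [MetricSpace Y] [CompactSpace Y] [MeasurableSpace Y] [BorelSpace Y]

theorem dualValue_add (μ : Prob X) (ν : Prob Y) {p p' : X → ℝ} {q q' : Y → ℝ} (hp : IsLip p)
    (hp' : IsLip p') (hq : IsLip q) (hq' : IsLip q') :
    dualValue μ ν (fun x => p x + p' x) (fun y => q y + q' y) =
      dualValue μ ν p q + dualValue μ ν p' q' := by
  simp only [dualValue]
  rw [integral_add (μ.integrable_of_continuous hp.continuous)
      (μ.integrable_of_continuous hp'.continuous),
    integral_add (ν.integrable_of_continuous hq.continuous)
      (ν.integrable_of_continuous hq'.continuous)]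
  ring

theorem dualValue_const_mul (μ : Prob X) (ν : Prob Y) (c : ℝ) (p : X → ℝ) (q : Y → ℝ) :
    dualValue μ ν (fun x => c * p x) (fun y => c * q y) = c * dualValue μ ν p q := by
  simp only [dualValue, integral_const_mul]
  ring

theorem NoEntry.add {V V' : X × Prob Y → ℝ} {p p' : X → ℝ} {q q' : Y → ℝ} (h : NoEntry V p q)
    (h' : NoEntry V' p' q') (hq : IsLip q) (hq' : IsLip q') :
    NoEntry (fun z => V z + V' z) (fun x => p x + p' x) (fun y => q y + q' y) := fun x η => by
  rw [integral_add (η.integrable_of_continuous hq.continuous)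
    (η.integrable_of_continuous hq'.continuous)]
  linarith [h x η, h' x η]

theorem NoEntry.const_mul {V : X × Prob Y → ℝ} {p : X → ℝ} {q : Y → ℝ} (h : NoEntry V p q) {c : ℝ}
    (hc : 0 ≤ c) : NoEntry (fun z => c * V z) (fun x => c * p x) (fun y => c * q y) := fun x η => by
  rw [integral_const_mul, ← mul_add]
  exact mul_le_mul_of_nonneg_left (h x η) hc

/-- The infimum of the dual problem for the value function `f`. -/
noncomputable def dualInf (μ : Prob X) (ν : Prob Y) (f : X × Prob Y → ℝ) : ℝ :=
  sInf {r | ∃ (p : X → ℝ) (q : Y → ℝ), IsLip p ∧ IsLip q ∧ NoEntry f p q ∧ r = dualValue μ ν p q}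

variable {μ : Prob X} {ν : Prob Y}

/-- Testing no entry at η = ν alone suffices. The bound makes the `sInf` in `dualInf` a true infimum
rather than a default value. -/
theorem NoEntry.le_dualValue {f : X × Prob Y → ℝ} {p : X → ℝ} {q : Y → ℝ} (h : NoEntry f p q)
    (hp : IsLip p) {m : ℝ} (hm : ∀ z, m ≤ f z) : m ≤ dualValue μ ν p q := by
  have : ∫ _x, (m - ∫ y, q y ∂ν.toMeasure) ∂μ.toMeasure ≤ ∫ x, p x ∂μ.toMeasure :=
    integral_mono (integrable_const _) (μ.integrable_of_continuous hp.continuous) fun x => by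
      have h1 := h x ν
      have h2 := hm (x, ν)
      simp only
      linarith
  simp only [integral_const, probReal_univ, one_smul] at this
  rw [dualValue]
  linarith

theorem exists_abs_le_of_continuous {f : X × Prob Y → ℝ} (hf : Continuous f) :
    ∃ C, ∀ z, |f z| ≤ C := by
  obtain ⟨C, hC⟩ := (isCompact_univ (X := X × Prob Y)).exists_bound_of_continuousOn hf.continuousOn
  exact ⟨C, fun z => hC z (mem_univ z)⟩

theorem dualInf_le {f : X × Prob Y → ℝ} (hf : Continuous f) {p : X → ℝ} {q : Y → ℝ}
    (hp : IsLip p) (hq : IsLip q) (h : NoEntry f p q) : dualInf μ ν f ≤ dualValue μ ν p q := by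
  obtain ⟨C, hC⟩ := exists_abs_le_of_continuous hf
  refine csInf_le ⟨-C, ?_⟩ ⟨p, q, hp, hq, h, rfl⟩
  rintro r ⟨p, q, hp, -, h, rfl⟩
  exact h.le_dualValue hp fun z => (abs_le.1 (hC z)).1

theorem le_dualInf {f : X × Prob Y → ℝ} (hf : Continuous f) {a : ℝ}
    (h : ∀ (p : X → ℝ) (q : Y → ℝ), IsLip p → IsLip q → NoEntry f p q → a ≤ dualValue μ ν p q) :
    a ≤ dualInf μ ν f := by
  obtain ⟨C, hC⟩ := exists_abs_le_of_continuous hf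
  refine le_csInf ⟨_, fun _ => C, fun _ => 0, .const C, .const 0,
    fun x η => by simpa using (abs_le.1 (hC (x, η))).2, rfl⟩ ?_
  rintro r ⟨p, q, hp, hq, hne, rfl⟩
  exact h p q hp hq hne

/-- Sums of feasible pairs are feasible for the sum; the infima are taken one pair at a time. -/
theorem dualInf_add_le {f g : X × Prob Y → ℝ} (hf : Continuous f) (hg : Continuous g) :
    dualInf μ ν (fun z => f z + g z) ≤ dualInf μ ν f + dualInf μ ν g := by
  rw [← sub_le_iff_le_add]
  refine le_dualInf hf fun p q hp hq h => ?_
  rw [sub_le_comm]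
  refine le_dualInf hg fun p' q' hp' hq' h' => ?_
  rw [sub_le_iff_le_add', ← dualValue_add μ ν hp hp' hq hq']
  exact dualInf_le (hf.add hg) (hp.add hp') (hq.add hq') (h.add h' hq hq')

theorem dualInf_const_mul_le {f : X × Prob Y → ℝ} (hf : Continuous f) {c : ℝ} (hc : 0 < c) :
    dualInf μ ν (fun z => c * f z) ≤ c * dualInf μ ν f := by
  rw [← div_le_iff₀' hc]
  refine le_dualInf hf fun p q hp hq h => ?_
  rw [div_le_iff₀' hc, ← dualValue_const_mul]
  exact dualInf_le (continuous_const.mul hf) (hp.const_mul c) (hq.const_mul c) (h.const_mul hc.le)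

theorem dualInf_const_mul {f : X × Prob Y → ℝ} (hf : Continuous f) {c : ℝ} (hc : 0 < c) :
    dualInf μ ν (fun z => c * f z) = c * dualInf μ ν f := by
  refine le_antisymm (dualInf_const_mul_le hf hc) ?_
  have := dualInf_const_mul_le (μ := μ) (ν := ν) (continuous_const.mul hf) (inv_pos.2 hc)
    (f := fun z => c * f z)
  simp only [inv_mul_cancel_left₀ hc.ne'] at this
  rwa [le_inv_mul_iff₀ hc] at this

open CompactlySupported in
/-- A linear functional below the dual infimum that touches it at `V`. -/
theorem exists_linear_le_dualInf (μ : Prob X) (ν : Prob Y) (V : C_c(X × Prob Y, ℝ)) :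
    ∃ Λ : C_c(X × Prob Y, ℝ) →ₗ[ℝ] ℝ, (∀ f, Λ f ≤ dualInf μ ν f) ∧ Λ V = dualInf μ ν V := by
  let N : C_c(X × Prob Y, ℝ) → ℝ := fun f => dualInf μ ν f
  have hom : ∀ c : ℝ, 0 < c → ∀ f, N (c • f) = c * N f := fun c hc f =>
    dualInf_const_mul f.continuous hc
  have sub : ∀ f g, N (f + g) ≤ N f + N g := fun f g => dualInf_add_le f.continuous g.continuous
  have zero : N 0 = 0 := by
    have := hom 2 two_pos 0
    rw [smul_zero] at this
    linarith
  -- On the line through V, the functional is c • V ↦ c · N V. For c < 0 it lies below N because 0 =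
  -- N 0 ≤ N (c • V) + N (-c • V).
  let φ : C_c(X × Prob Y, ℝ) →ₗ.[ℝ] ℝ := LinearPMap.mkSpanSingleton' V (N V) fun c hc => by
    rcases smul_eq_zero.1 hc with rfl | rfl
    · simp
    · rw [zero, smul_zero]
  obtain ⟨Λ, hφ, hN⟩ := exists_extension_of_le_sublinear φ N hom sub (by
    rintro ⟨f, hf⟩
    obtain ⟨c, rfl⟩ := Submodule.mem_span_singleton.1 hf
    change LinearPMap.mkSpanSingleton' V (N V) _ ⟨c • V, hf⟩ ≤ N (c • V)
    rw [LinearPMap.mkSpanSingleton'_apply]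
    simp only [RingHom.id_apply, smul_eq_mul]
    rcases lt_trichotomy c 0 with hc | rfl | hc
    · have h1 := sub (c • V) ((-c) • V)
      have h2 : c • V + (-c) • V = 0 := by
        ext z
        simp
      rw [h2, zero, hom (-c) (neg_pos.2 hc)] at h1
      linarith
    · simp [zero]
    · exact (hom c hc V).ge)
  refine ⟨Λ, hN, ?_⟩
  have hV : V ∈ φ.domain := Submodule.mem_span_singleton_self V
  rw [hφ ⟨V, hV⟩]
  exact LinearPMap.mkSpanSingleton'_apply_self _ _ _ _

open CompactlySupported in
/-- Some assignment attains the infimum of the dual problem. -/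
theorem exists_isAssignment_primalValue_eq_dualInf (μ : Prob X) (ν : Prob Y)
    {V : X × Prob Y → ℝ} (hV : Continuous V) :
    ∃ γ : Prob (X × Prob Y), IsAssignment μ ν γ ∧ primalValue V γ = dualInf μ ν V := by
  let toCc : ∀ f : X × Prob Y → ℝ, Continuous f → C_c(X × Prob Y, ℝ) := fun f hf =>
    ⟨⟨f, hf⟩, HasCompactSupport.of_compactSpace f⟩
  obtain ⟨Λ, hΛ, hΛV⟩ := exists_linear_le_dualInf μ ν (toCc V hV)
  -- For f ≥ 0 the zero prices are feasible for -f, so Λ (-f) ≤ 0.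
  let Λ' : C_c(X × Prob Y, ℝ) →ₚ[ℝ] ℝ := PositiveLinearMap.mk₀ Λ fun f hf => by
    have h1 : Λ (-f) ≤ 0 := (hΛ (-f)).trans <| by
      have := dualInf_le (μ := μ) (ν := ν) (-f).continuous (.const 0) (.const 0) fun x η => by
        simpa using hf (x, η)
      simpa [dualValue] using this
    rw [map_neg] at h1
    linarith
  have hint : ∀ f : C_c(X × Prob Y, ℝ), ∫ z, f z ∂(RealRMK.rieszMeasure Λ') = Λ f :=
    RealRMK.integral_rieszMeasure Λ'
  -- The pair (p, q) is feasible for p + E[q], and (-p, -q) for its negative; the two bounds on Λ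
  -- coincide.
  have hfeas : ∀ (p : X → ℝ) (q : Y → ℝ) (hp : IsLip p) (hq : IsLip q),
      ∫ z : X × Prob Y, (p z.1 + ∫ y, q y ∂z.2.toMeasure) ∂(RealRMK.rieszMeasure Λ') =
        dualValue μ ν p q := by
    intro p q hp hq
    have hcont : Continuous fun z : X × Prob Y => p z.1 + ∫ y, q y ∂z.2.toMeasure :=
      (hp.continuous.comp continuous_fst).add (hq.continuous_integral.comp continuous_snd)
    refine (hint (toCc _ hcont)).trans (le_antisymm ((hΛ _).trans ?_) ?_)
    · exact dualInf_le hcont hp hq fun x η => le_rfl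
    · have h1 := (hΛ (-toCc _ hcont)).trans (dualInf_le (μ := μ) (ν := ν)
        (-toCc _ hcont).continuous (hp.const_mul (-1)) (hq.const_mul (-1)) fun x η => by
          rw [integral_const_mul]
          change -(p x + ∫ y, q y ∂η.toMeasure) ≤ _
          linarith)
      rw [map_neg, dualValue_const_mul] at h1
      linarith
  have hprob : IsProbabilityMeasure (RealRMK.rieszMeasure Λ') := by
    -- The prices p = 1, q = 0 read off the total mass.
    have h1 := hfeas (fun _ => 1) (fun _ => 0) (.const 1) (.const 0)
    simp only [integral_zero, add_zero, integral_const, smul_eq_mul, mul_one, dualValue,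
      probReal_univ] at h1
    exact ⟨by simpa [Measure.real, ENNReal.toReal_eq_one_iff] using h1⟩
  let γ : Prob (X × Prob Y) := ⟨RealRMK.rieszMeasure Λ', hprob⟩
  refine ⟨γ, isAssignment_iff.2 ⟨?_, ?_⟩, (hint (toCc V hV)).trans hΛV⟩
  · refine Prob.eq_of_integral_lipschitz_eq fun p hp => ?_
    rw [γ.integral_fst hp.continuous]
    simpa [dualValue] using hfeas p (fun _ => 0) hp (.const 0)
  · refine Prob.eq_of_integral_lipschitz_eq fun q hq => ?_
    rw [γ.integral_average hq.continuous]
    simpa [dualValue] using hfeas (fun _ => 0) q (.const 0) hq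

/-! ### Equilibria as pairs of solutions. -/

theorem SolvesDual.dualInf_eq {V : X × Prob Y → ℝ} (hV : Continuous V) {p : X → ℝ} {q : Y → ℝ}
    (h : SolvesDual V μ ν p q) : dualInf μ ν V = dualValue μ ν p q :=
  le_antisymm (dualInf_le hV h.1 h.2.1 h.2.2.1) (le_dualInf hV h.2.2.2)

theorem SolvesPrimal.primalValue_eq_dualValue {V : X × Prob Y → ℝ} (hV : Continuous V)
    {γ : Prob (X × Prob Y)} {p : X → ℝ} {q : Y → ℝ} (hγ : SolvesPrimal V μ ν γ)
    (h : SolvesDual V μ ν p q) : primalValue V γ = dualValue μ ν p q := by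
  obtain ⟨γ', hγ', he⟩ := exists_isAssignment_primalValue_eq_dualInf μ ν hV
  refine le_antisymm (hγ.1.primalValue_le_dualValue hV h.1 h.2.1 h.2.2.1) ?_
  rw [← h.dualInf_eq hV, ← he]
  exact hγ.2 γ' hγ'

theorem IsEquilibrium.primalValue_eq_dualValue {V : X × Prob Y → ℝ} (hV : Continuous V)
    {γ : Prob (X × Prob Y)} {p : X → ℝ} {q : Y → ℝ} (h : IsEquilibrium V μ ν γ p q) :
    primalValue V γ = dualValue μ ν p q :=
  (h.1.isEquilibrium_iff hV h.2.1 h.2.2.1 h.2.2.2.2).1 h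

/-- In an equilibrium the values agree, so by weak duality each side certifies that the other is
optimal. Conversely, absence of a gap makes optimal values agree, and complementary slackness
applies. -/
theorem isEquilibrium_iff_solves {V : X × Prob Y → ℝ} (hV : Continuous V)
    {γ : Prob (X × Prob Y)} {p : X → ℝ} {q : Y → ℝ} :
    IsEquilibrium V μ ν γ p q ↔ SolvesPrimal V μ ν γ ∧ SolvesDual V μ ν p q := by
  constructor
  · intro h
    have he := h.primalValue_eq_dualValue hV
    obtain ⟨hγ, hp, hq, -, hne⟩ := h
    refine ⟨⟨hγ, fun γ' hγ' => ?_⟩, hp, hq, hne, fun p' q' hp' hq' hne' => ?_⟩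
    · rw [he]
      exact hγ'.primalValue_le_dualValue hV hp hq hne
    · rw [← he]
      exact hγ.primalValue_le_dualValue hV hp' hq' hne'
  · rintro ⟨hγ, hd⟩
    exact (hγ.1.isEquilibrium_iff hV hd.1 hd.2.1 hd.2.2.1).2 (hγ.primalValue_eq_dualValue hV hd)

theorem exists_isEquilibrium (μ : Prob X) (ν : Prob Y) {V : X × Prob Y → ℝ} (hV : IsLip V) :
    ∃ (γ : Prob (X × Prob Y)) (p : X → ℝ) (q : Y → ℝ), IsEquilibrium V μ ν γ p q := by
  obtain ⟨p, q, hd⟩ := exists_solvesDual μ ν hV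
  obtain ⟨γ, hγ, he⟩ := exists_isAssignment_primalValue_eq_dualInf μ ν hV.continuous
  exact ⟨γ, p, q, (hγ.isEquilibrium_iff hV.continuous hd.1 hd.2.1 hd.2.2.1).2
    (he.trans (hd.dualInf_eq hV.continuous))⟩

end StrongDuality

end Matching

theorem theorem1 {X Y : Type*}
    [MetricSpace X] [CompactSpace X] [MeasurableSpace X] [BorelSpace X]
    [MetricSpace Y] [CompactSpace Y] [MeasurableSpace Y] [BorelSpace Y]
    (μ : Matching.Prob X) (ν : Matching.Prob Y)
    (V : X × Matching.Prob Y → ℝ) (hV : Matching.IsLip V) :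
    (∃ (γ : Matching.Prob (X × Matching.Prob Y)) (p : X → ℝ) (q : Y → ℝ),
      Matching.IsEquilibrium V μ ν γ p q) ∧
    (∀ (γ : Matching.Prob (X × Matching.Prob Y)) (p : X → ℝ) (q : Y → ℝ),
      Matching.IsEquilibrium V μ ν γ p q ↔
        Matching.SolvesPrimal V μ ν γ ∧ Matching.SolvesDual V μ ν p q) ∧
    (∃ γ : Matching.Prob (X × Matching.Prob Y), Matching.SolvesPrimal V μ ν γ) ∧
    (∃ (p : X → ℝ) (q : Y → ℝ), Matching.SolvesDual V μ ν p q) ∧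
    (∀ (γ : Matching.Prob (X × Matching.Prob Y)) (p : X → ℝ) (q : Y → ℝ),
      Matching.SolvesPrimal V μ ν γ → Matching.SolvesDual V μ ν p q →
        Matching.primalValue V γ = Matching.dualValue μ ν p q) := by
  have hc := hV.continuous
  exact ⟨Matching.exists_isEquilibrium μ ν hV,
    fun γ p q => Matching.isEquilibrium_iff_solves hc,
    (Matching.exists_isEquilibrium μ ν hV).imp fun γ ⟨p, q, h⟩ =>
      ((Matching.isEquilibrium_iff_solves hc).1 h).1,
    Matching.exists_solvesDual μ ν hV,
    fun γ p q hγ hd => hγ.primalValue_eq_dualValue hc hd⟩
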